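/- Let $\mathcal N=\{1,\dots,n\}$ be a finite set of products and let $\mathcal S$ be a collection of subsets of $\mathcal N$ (assortments). A choice probability collection over $\mathcal S$ is $p_{\mathcal S}=(p_{i,S}: S\in\mathcal S,\ i\in S)$ with $p_{i,S}\ge 0$ and $\sum_{i\in S}p_{i,S}=1$ for all $S\in\mathcal S$. It is MDM-representable (representable by a marginal distribution model), written $p_{\mathcal S}\in\mathcal P_{\rm MDM}(\mathcal S)$, if there are deterministic utilities $\nu_1,\dots,\nu_n\in\mathbb R$ and marginal laws $F_1,\dots,F_n$ on $\mathbb R$, each absolutely continuous, with a distribution function that is strictly increasing on its support, and with finite first absolute moment, such that for every $S\in\mathcal S$ there is a joint law $\theta^*$ of $(\tilde\epsilon_1,\dots,\tilde\epsilon_n)$ with marginals $F_1,\dots,F_n$ which maximizes $\mathbb E_{\theta}\big[\max_{i\in S}(\nu_i+\tilde\epsilon_i)\big]$ over all joint laws $\theta$ with these marginals, and $p_{i,S}=\mathbb P_{\theta^*}\big(i=\arg\max_{j\in S}(\nu_j+\tilde\epsilon_j)\big)$ for all $i\in S$. Suppose that $p_{\mathcal S}\in\mathcal P_{\rm MDM}(\mathcal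 S)$, let $A\subseteq\mathcal N$ be a nonempty assortment with $A\notin\mathcal S$, and let $r_i\in(0,\infty)$ for $i\in\mathcal N$. Put $\mathcal S'=\mathcal S\cup\{A\}$ and let $\mathcal U_A=\{x_A=(x_{i,A}:i\in A): (p_{\mathcal S},x_A)\in\mathcal P_{\rm MDM}(\mathcal S')\}$ be the set of vectors for $A$ that are consistent with the data. Then $\mathcal U_A$ is nonempty, and the worst-case expected revenue $$\underline r(A)=\inf_{x_A\in\mathcal U_A}\ \sum_{i\in A}r_i x_{i,A}$$ is equal to the optimal value, which is attained, of the problem $$\begin{aligned}\min_{x_A\in\mathbb R^{A},\ \lambda\in\mathbb R^{\mathcal S'}}\ & \sum_{i\in A}r_i x_{i,A}\\ \text{s.t. } & x_{i,A}\le p_{i,S}\ \text{ if }\lambda_A\ge\lambda_S, && i\in A\cap S,\ S\in\mathcal S,\\ & x_{i,A}\ge p_{i,S}\ \text{ if }\lambda_A\le\lambda_S, && i\in A\cap S,\ S\in\mathcal S,\\ & \textstyle\sum_{i\in A}x_{i,A}=1,\quad x_{i,A}\ge 0, && i\in A,\\ & \lambda_S>\lambda_T\ \text{ if } p_{i,S}<p_{i,T},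 && i\in S\cap T,\ S,T\in\mathcal S,\\ & \lambda_S=\lambda_T\ \text{ if } p_{i,S}=p_{i,T}\ne 0, && i\in S\cap T,\ S,T\in\mathcal S.\end{aligned}$$ Moreover, the set of all $x_A$ for which some $\lambda\in\mathbb R^{\mathcal S'}$ satisfies these constraints is the closure of $\mathcal U_A$ in $\mathbb R^A$. -/

import Mathlib

open MeasureTheory ProbabilityTheory Set

/-- The standing assumption on the law `μ` of one stochastic utility term: an absolutely continuous
probability law whose distribution function is strictly increasing on its support and which has a
finite first absolute moment. -/
structure IsAdmissibleMarginal (μ : Measure ℝ) : Prop where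
  isProbabilityMeasure : IsProbabilityMeasure μ
  absolutelyContinuous : μ ≪ volume
  strictMonoOn_cdf : StrictMonoOn (cdf μ) μ.support
  integrable : Integrable (fun t : ℝ => t) μ

/-- The joint laws of the stochastic utility terms with the given marginal laws
(no assumption on their dependence). -/
def jointLaws {n : ℕ} (F : Fin n → Measure ℝ) : Set (Measure (Fin n → ℝ)) :=
  {θ | IsProbabilityMeasure θ ∧ ∀ i, θ.map (fun ε => ε i) = F i}

/-- Expected utility of the best product of the assortment `S`, under the joint law `θ`:
`E_θ[max_{i ∈ S} (ν_i + ε_i)]`. -/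
noncomputable def expectedMaxUtility {n : ℕ} (ν : Fin n → ℝ) (S : Finset (Fin n))
    (θ : Measure (Fin n → ℝ)) : ℝ :=
  ∫ ε, ⨆ i : S, (ν i + ε i) ∂θ

/-- The probability under `θ` that `i` is the utility maximizer in `S`. -/
noncomputable def choiceProb {n : ℕ} (ν : Fin n → ℝ) (S : Finset (Fin n))
    (θ : Measure (Fin n → ℝ)) (i : Fin n) : ℝ :=
  θ.real {ε | ∀ j ∈ S, j ≠ i → ν j + ε j < ν i + ε i}

/-- `q i`, `i ∈ S`, are the choice probabilities for the assortment `S` in the marginal distribution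
model with deterministic utilities `ν` and marginal laws `F`: the probabilities of being chosen
under a joint law that attains the largest expected maximal utility among all joint laws with
marginals `F`. -/
def IsMDMChoice {n : ℕ} (ν : Fin n → ℝ) (F : Fin n → Measure ℝ) (S : Finset (Fin n))
    (q : Fin n → ℝ) : Prop :=
  ∃ θ ∈ jointLaws F, IsMaxOn (expectedMaxUtility ν S) (jointLaws F) θ ∧
    ∀ i ∈ S, q i = choiceProb ν S θ i

/-- `p S i` (for `S ∈ 𝒮`, `i ∈ S`) is a collection of choice probabilities over `𝒮`.
Here and below only the entries `p S i` with `S ∈ 𝒮` and `i ∈ S` matter. -/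
def IsChoiceCollection {n : ℕ} (𝒮 : Finset (Finset (Fin n)))
    (p : Finset (Fin n) → Fin n → ℝ) : Prop :=
  ∀ S ∈ 𝒮, (∀ i ∈ S, 0 ≤ p S i) ∧ ∑ i ∈ S, p S i = 1

/-- The choice probability collection `p` over `𝒮` is representable by a marginal distribution
model: one choice of deterministic utilities and of admissible marginals explains all the
assortments in `𝒮`. -/
def IsMDMRepresentable {n : ℕ} (𝒮 : Finset (Finset (Fin n)))
    (p : Finset (Fin n) → Fin n → ℝ) : Prop :=
  IsChoiceCollection 𝒮 p ∧
    ∃ (ν : Fin n → ℝ) (F : Fin n → Measure ℝ), (∀ i, IsAdmissibleMarginal (F i)) ∧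
      ∀ S ∈ 𝒮, IsMDMChoice ν F S (p S)

/-- The collection `(p, x)`: the data `p` together with the vector `x` for the assortment `A`. -/
def extendData {n : ℕ} (p : Finset (Fin n) → Fin n → ℝ) (A : Finset (Fin n)) (x : A → ℝ) :
    Finset (Fin n) → Fin n → ℝ :=
  fun S i => if h : S = A ∧ i ∈ A then x ⟨i, h.2⟩ else p S i

/-- The choice probability vectors for the new assortment `A` that are consistent with the
data `p` over `𝒮` under the marginal distribution model. -/
def consistentSet {n : ℕ} (𝒮 : Finset (Finset (Fin n))) (p : Finset (Fin n) → Fin n → ℝ)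
    (A : Finset (Fin n)) : Set (A → ℝ) :=
  {x | IsMDMRepresentable (insert A 𝒮) (extendData p A x)}

/-- Expected revenue from the assortment `A`. -/
def revenue {n : ℕ} (r : Fin n → ℝ) (A : Finset (Fin n)) (x : A → ℝ) : ℝ :=
  ∑ i : A, r i * x i

/-- Worst-case expected revenue over the consistent choice probability vectors. -/
noncomputable def worstCaseRevenue {n : ℕ} (𝒮 : Finset (Finset (Fin n)))
    (p : Finset (Fin n) → Fin n → ℝ) (r : Fin n → ℝ) (A : Finset (Fin n)) : ℝ :=
  sInf (revenue r A '' consistentSet 𝒮 p A)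

/-- The constraints of the reformulation, in the variables `x` and `lam`
(only the values of `lam` on `𝒮 ∪ {A}` matter). -/
structure IsFeasible {n : ℕ} (𝒮 : Finset (Finset (Fin n))) (p : Finset (Fin n) → Fin n → ℝ)
    (A : Finset (Fin n)) (x : A → ℝ) (lam : Finset (Fin n) → ℝ) : Prop where
  le_data : ∀ S ∈ 𝒮, ∀ i : A, (i : Fin n) ∈ S → lam S ≤ lam A → x i ≤ p S i
  data_le : ∀ S ∈ 𝒮, ∀ i : A, (i : Fin n) ∈ S → lam A ≤ lam S → p S i ≤ x i
  sum_eq_one : ∑ i : A, x i = 1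
  nonneg : ∀ i : A, 0 ≤ x i
  lam_lt : ∀ S ∈ 𝒮, ∀ T ∈ 𝒮, ∀ i, i ∈ S → i ∈ T → p S i < p T i → lam T < lam S
  lam_eq : ∀ S ∈ 𝒮, ∀ T ∈ 𝒮, ∀ i, i ∈ S → i ∈ T → p S i = p T i → p S i ≠ 0 → lam S = lam T

/-!
For every threshold `l`, the maximal utility in `S` is at most `l + ∑ i ∈ S, (ν i + ε i - l)⁺`,
with equality when exactly one utility exceeds `l`. The expectation of the bound depends on the
marginals only, so a coupling under which exactly one utility exceeds `l` almost surely is optimal.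
Such a coupling exists as soon as the survival probabilities `P(ν i + ε i > l)`, `i ∈ S`, have sum
`1`, and these are then the choice probabilities under every optimal coupling.

Hence data are representable if and only if, for suitable thresholds `lam S`, the choice
probabilities of each product are the values of its survival function at the thresholds. Finitely
many values in the right order can be interpolated by a survival function, so only the order of the
thresholds matters.

A vector satisfying the constraints is a limit of consistent ones: interpolate the data by survival
functions that pass within `δ` of `x i` at `lam A`, then shift the threshold of `A` until the values
have sum `1` again. All the functions are antitone, so this moves none of them by more than the
defect in the sum, which is at most `card A * δ`.
-/

/-! ### Coupling laws so that exactly one event occurs -/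

section Coupling

variable {ι : Type*} {X : ι → Type*}

/-- The events that occur together exactly when `i` is the only index whose event in the family `E`
occurs. -/
def soloEvent [DecidableEq ι] (E : ∀ i, Set (X i)) (i j : ι) : Set (X j) :=
  if j = i then E j else (E j)ᶜ

variable [∀ i, MeasurableSpace (X i)]

lemma measurableSet_soloEvent [DecidableEq ι] {E : ∀ i, Set (X i)}
    (hE : ∀ i, MeasurableSet (E i)) (i j : ι) : MeasurableSet (soloEvent E i j) := by
  unfold soloEvent
  split_ifs
  exacts [hE j, (hE j).compl]

variable [Fintype ι]

/-- The product law under which `i` is almost surely the only index whose event in the family `E`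
occurs: the factors are the laws `P`, conditioned on `soloEvent E i`. -/
noncomputable def soloLaw [DecidableEq ι] (P : ∀ i, Measure (X i)) (E : ∀ i, Set (X i)) (i : ι) :
    Measure (∀ i, X i) :=
  Measure.pi fun j => (P j)[|soloEvent E i j]

variable {P : ∀ i, Measure (X i)} {E : ∀ i, Set (X i)}

lemma ae_soloLaw [DecidableEq ι] (hE : ∀ i, MeasurableSet (E i)) (i : ι) :
    ∀ᵐ ε ∂soloLaw P E i, ∃! j, ε j ∈ E j := by
  have hmem : ∀ j, ∀ᵐ ε ∂soloLaw P E i, ε j ∈ soloEvent E i j := fun j =>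
    Measure.tendsto_eval_ae_ae.eventually (ae_cond_mem (measurableSet_soloEvent hE i j))
  filter_upwards [ae_all_iff.2 hmem] with ε hε
  refine ⟨i, by simpa [soloEvent] using hε i, fun j hj => ?_⟩
  by_contra hji
  have := hε j
  simp_all [soloEvent]

variable [∀ i, IsProbabilityMeasure (P i)]

lemma isProbabilityMeasure_cond_soloEvent [DecidableEq ι] (hE : ∀ i, MeasurableSet (E i))
    (hsum : ∑ i, P i (E i) = 1) {i : ι} (hi : P i (E i) ≠ 0) (j : ι) :
    IsProbabilityMeasure ((P j)[|soloEvent E i j]) := by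
  refine cond_isProbabilityMeasure ?_
  by_cases hji : j = i
  · subst hji
    simpa [soloEvent] using hi
  · simp only [soloEvent, if_neg hji]
    intro hcompl
    have hj : P j (E j) = 1 := (prob_compl_eq_zero_iff (hE j)).1 hcompl
    have hpair : P i (E i) + P j (E j) ≤ 0 + P j (E j) := by
      rw [zero_add, ← Finset.sum_pair (f := fun k => P k (E k)) (Ne.symm hji), hj, ← hsum]
      exact Finset.sum_le_sum_of_subset (Finset.subset_univ _)
    exact hi (nonpos_iff_eq_zero.1 ((ENNReal.add_le_add_iff_right (measure_ne_top _ _)).1 hpair))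

lemma map_eval_smul_soloLaw [DecidableEq ι] (hE : ∀ i, MeasurableSet (E i))
    (hsum : ∑ i, P i (E i) = 1) (i j : ι) :
    (P i (E i) • soloLaw P E i).map (Function.eval j) =
      P i (E i) • (P j)[|soloEvent E i j] := by
  by_cases hi : P i (E i) = 0
  · simp [hi]
  have := isProbabilityMeasure_cond_soloEvent hE hsum hi
  rw [Measure.map_smul, soloLaw,
    (measurePreserving_eval (fun j => (P j)[|soloEvent E i j]) j).map_eq]

lemma sum_smul_cond_soloEvent [DecidableEq ι] (hE : ∀ i, MeasurableSet (E i))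
    (hsum : ∑ i, P i (E i) = 1) (j : ι) :
    ∑ i, P i (E i) • (P j)[|soloEvent E i j] = P j := by
  have hcompl : ∑ i ∈ Finset.univ.erase j, P i (E i) = P j (E j)ᶜ := by
    rw [prob_compl_eq_one_sub (hE j), ← hsum, ← Finset.add_sum_erase _ _ (Finset.mem_univ j),
      ENNReal.add_sub_cancel_left (measure_ne_top _ _)]
  have herase : ∑ i ∈ Finset.univ.erase j, P i (E i) • (P j)[|soloEvent E i j] =
      P j (E j)ᶜ • (P j)[|(E j)ᶜ] := by
    rw [← hcompl, Finset.sum_smul]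
    refine Finset.sum_congr rfl fun i hi => ?_
    simp [soloEvent, (Finset.ne_of_mem_erase hi).symm]
  rw [← Finset.add_sum_erase _ _ (Finset.mem_univ j), herase]
  ext s _
  simp [soloEvent, ← cond_add_cond_compl_eq (hE j) (P j) (t := s), mul_comm]

theorem exists_coupling_existsUnique_mem (hE : ∀ i, MeasurableSet (E i))
    (hsum : ∑ i, P i (E i) = 1) :
    ∃ θ : Measure (∀ i, X i), (∀ j, θ.map (Function.eval j) = P j) ∧
      ∀ᵐ ε ∂θ, ∃! j, ε j ∈ E j := by
  classical
  refine ⟨∑ i, P i (E i) • soloLaw P E i, fun j => ?_, ?_⟩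
  · rw [Measure.map_finset_sum (measurable_pi_apply j).aemeasurable]
    simp only [map_eval_smul_soloLaw hE hsum, sum_smul_cond_soloEvent hE hsum]
  · exact ae_finsetSum_measure_iff.2 fun i _ => Measure.ae_smul_measure (ae_soloLaw hE i) _

end Coupling

/-! ### Thresholds and optimal couplings -/

section Threshold

variable {ι : Type*} {S : Finset ι} {u : ι → ℝ} {l : ℝ}

lemma iSup_le_add_sum_posPart (hS : S.Nonempty) (u : ι → ℝ) (l : ℝ) :
    ⨆ i : S, u i ≤ l + ∑ i ∈ S, max (u i - l) 0 := by
  have : Nonempty S := hS.to_subtype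
  refine ciSup_le fun i => ?_
  have := Finset.single_le_sum (f := fun i => max (u i - l) 0) (fun j _ => le_max_right _ _) i.2
  linarith [le_max_left (u i - l) 0]

lemma iSup_eq_add_sum_posPart (h : ∃! i, i ∈ S ∧ l < u i) :
    ⨆ i : S, u i = l + ∑ i ∈ S, max (u i - l) 0 := by
  obtain ⟨i, ⟨hi, hli⟩, huniq⟩ := h
  refine le_antisymm (iSup_le_add_sum_posPart ⟨i, hi⟩ u l) ?_
  have hle : u i ≤ ⨆ i : S, u i :=
    le_ciSup (f := fun i : S => u i) (Set.finite_range _).bddAbove ⟨i, hi⟩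
  rw [Finset.sum_eq_single_of_mem i hi, max_eq_left (by linarith)]
  · linarith
  · intro j hj hji
    exact max_eq_right (sub_nonpos.2 (not_lt.1 fun hlj => hji (huniq j ⟨hj, hlj⟩)))

lemma existsUnique_lt_of_iSup_eq (hS : S.Nonempty) (hne : ∀ i ∈ S, u i ≠ l)
    (h : ⨆ i : S, u i = l + ∑ i ∈ S, max (u i - l) 0) : ∃! i, i ∈ S ∧ l < u i := by
  classical
  have : Nonempty S := hS.to_subtype
  obtain ⟨⟨k, hk⟩, hkmax : u k = _⟩ := exists_eq_ciSup_of_finite (f := fun i : S => u i)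
  rw [← hkmax, ← Finset.add_sum_erase _ _ hk] at h
  have hrest : 0 ≤ ∑ i ∈ S.erase k, max (u i - l) 0 :=
    Finset.sum_nonneg fun _ _ => le_max_right _ _
  have hlk : l < u k :=
    lt_of_le_of_ne (by linarith [le_max_right (u k - l) 0]) (hne k hk).symm
  rw [max_eq_left (by linarith)] at h
  refine ⟨k, ⟨hk, hlk⟩, fun j ⟨hj, hlj⟩ => ?_⟩
  by_contra hjk
  have hzero := (Finset.sum_eq_zero_iff_of_nonneg fun _ _ => le_max_right _ _).1
    (le_antisymm (by linarith) hrest) j (Finset.mem_erase.2 ⟨hjk, hj⟩)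
  linarith [le_max_left (u j - l) 0]

lemma forall_lt_iff_of_existsUnique_lt (h : ∃! i, i ∈ S ∧ l < u i) {i : ι} (hi : i ∈ S) :
    (∀ j ∈ S, j ≠ i → u j < u i) ↔ l < u i := by
  obtain ⟨k, ⟨hk, hlk⟩, huniq⟩ := h
  constructor
  · intro hmax
    by_cases hki : k = i
    · exact hki ▸ hlk
    · exact hlk.trans (hmax k hk hki)
  · intro hli j hj hji
    have hjl : u j ≤ l :=
      not_lt.1 fun hlj => hji ((huniq j ⟨hj, hlj⟩).trans (huniq i ⟨hi, hli⟩).symm)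
    exact hjl.trans_lt hli

end Threshold

section OptimalCoupling

variable {n : ℕ} {ν : Fin n → ℝ} {F : Fin n → Measure ℝ} {S : Finset (Fin n)} {l : ℝ}
  {θ : Measure (Fin n → ℝ)}

/-- The upper bound `l + ∑ i ∈ S, E[(ν i + ε i - l)⁺]` on the expected maximal utility over all
joint laws, from the dual of the optimization over couplings. It only depends on the marginals. -/
noncomputable def thresholdBound (ν : Fin n → ℝ) (F : Fin n → Measure ℝ)
    (S : Finset (Fin n)) (l : ℝ) : ℝ :=
  l + ∑ i ∈ S, ∫ t, max (ν i + t - l) 0 ∂(F i)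

lemma measurePreserving_eval_of_mem_jointLaws (hθ : θ ∈ jointLaws F) (i : Fin n) :
    MeasurePreserving (fun ε : Fin n → ℝ => ε i) θ (F i) :=
  ⟨measurable_pi_apply i, hθ.2 i⟩

section Integrable

variable (hF : ∀ i, Integrable (fun t : ℝ => t) (F i)) (hθ : θ ∈ jointLaws F)
include hF hθ

lemma integrable_eval_of_mem_jointLaws (i : Fin n) :
    Integrable (fun ε : Fin n → ℝ => ε i) θ :=
  (measurePreserving_eval_of_mem_jointLaws hθ i).integrable_comp_of_integrable (hF i)

lemma integrable_posPart_utility (ν : Fin n → ℝ) (l : ℝ) (i : Fin n) :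
    Integrable (fun ε : Fin n → ℝ => max (ν i + ε i - l) 0) θ := by
  have := hθ.1
  exact (((integrable_const _).add (integrable_eval_of_mem_jointLaws hF hθ i)).sub
    (integrable_const _)).pos_part

lemma integrable_add_sum_posPart (ν : Fin n → ℝ) (S : Finset (Fin n)) (l : ℝ) :
    Integrable (fun ε => l + ∑ i ∈ S, max (ν i + ε i - l) 0) θ := by
  have := hθ.1
  exact (integrable_const l).add
    (integrable_finsetSum S fun i _ => integrable_posPart_utility hF hθ ν l i)

lemma integral_add_sum_posPart (ν : Fin n → ℝ) (S : Finset (Fin n)) (l : ℝ) :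
    ∫ ε, (l + ∑ i ∈ S, max (ν i + ε i - l) 0) ∂θ = thresholdBound ν F S l := by
  have := hθ.1
  have hint := integrable_posPart_utility hF hθ ν l
  rw [integral_add (integrable_const l) (integrable_finsetSum S fun i _ => hint i),
    integral_finsetSum S fun i _ => hint i, integral_const, probReal_univ, one_smul,
    thresholdBound]
  congr 1
  refine Finset.sum_congr rfl fun i _ => ?_
  have hmeas : Measurable fun t : ℝ => max (ν i + t - l) 0 := by fun_prop
  rw [← hθ.2 i, integral_map (measurable_pi_apply i).aemeasurable hmeas.aestronglyMeasurable]

lemma integrable_iSup_utility (ν : Fin n → ℝ) (hS : S.Nonempty) :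
    Integrable (fun ε => ⨆ i : S, (ν i + ε i)) θ := by
  have := hθ.1
  have : Nonempty S := hS.to_subtype
  have habs : ∀ i, Integrable (fun ε : Fin n → ℝ => |ν i + ε i|) θ := fun i =>
    ((integrable_const (ν i)).add (integrable_eval_of_mem_jointLaws hF hθ i)).abs
  have hmeas : Measurable fun ε : Fin n → ℝ => ⨆ i : S, (ν i + ε i) :=
    Measurable.iSup fun i => by fun_prop
  refine Integrable.mono' (integrable_finsetSum S fun i _ => habs i)
    hmeas.aestronglyMeasurable (.of_forall fun ε => ?_)
  obtain ⟨k, hk⟩ := exists_eq_ciSup_of_finite (f := fun i : S => ν i + ε i)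
  rw [← hk, Real.norm_eq_abs]
  exact Finset.single_le_sum (f := fun i => |ν i + ε i|) (fun _ _ => abs_nonneg _) k.2

lemma expectedMaxUtility_le_thresholdBound (ν : Fin n → ℝ) (hS : S.Nonempty) (l : ℝ) :
    expectedMaxUtility ν S θ ≤ thresholdBound ν F S l := by
  rw [← integral_add_sum_posPart hF hθ ν S l]
  exact integral_mono (integrable_iSup_utility hF hθ ν hS) (integrable_add_sum_posPart hF hθ ν S l)
    fun ε => iSup_le_add_sum_posPart hS (fun i => ν i + ε i) l

lemma ae_existsUnique_of_expectedMaxUtility_eq [∀ i, NullSingletonClass (F i)] (hS : S.Nonempty)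
    (h : expectedMaxUtility ν S θ = thresholdBound ν F S l) :
    ∀ᵐ ε ∂θ, ∃! i, i ∈ S ∧ l < ν i + ε i := by
  rw [← integral_add_sum_posPart hF hθ ν S l, expectedMaxUtility,
    integral_eq_iff_of_ae_le (integrable_iSup_utility hF hθ ν hS)
      (integrable_add_sum_posPart hF hθ ν S l)
      (.of_forall fun ε => iSup_le_add_sum_posPart hS (fun i => ν i + ε i) l)] at h
  have hne : ∀ i, ∀ᵐ ε ∂θ, ε i ≠ l - ν i := fun i =>
    (measurePreserving_eval_of_mem_jointLaws hθ i).quasiMeasurePreserving.ae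
      (Measure.ae_ne (F i) (l - ν i))
  filter_upwards [h, ae_all_iff.2 hne] with ε hε hεne
  exact existsUnique_lt_of_iSup_eq hS (fun i _ hil => hεne i (eq_sub_of_add_eq' hil)) hε

lemma choiceProb_eq_of_expectedMaxUtility_eq [∀ i, NullSingletonClass (F i)]
    (h : expectedMaxUtility ν S θ = thresholdBound ν F S l) {i : Fin n} (hi : i ∈ S) :
    choiceProb ν S θ i = (F i).real (Ioi (l - ν i)) := by
  rw [choiceProb, ← hθ.2 i, map_measureReal_apply (measurable_pi_apply i) measurableSet_Ioi]
  refine measureReal_congr ?_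
  filter_upwards [ae_existsUnique_of_expectedMaxUtility_eq hF hθ ⟨i, hi⟩ h] with ε hε
  exact propext ((forall_lt_iff_of_existsUnique_lt (u := fun i => ν i + ε i) hε hi).trans
    sub_lt_iff_lt_add'.symm)

end Integrable

lemma exists_mem_jointLaws_ae_existsUnique [∀ i, IsProbabilityMeasure (F i)]
    (hl : ∑ i ∈ S, (F i).real (Ioi (l - ν i)) = 1) :
    ∃ θ ∈ jointLaws F, ∀ᵐ ε ∂θ, ∃! i, i ∈ S ∧ l < ν i + ε i := by
  have hsum : ∑ i, F i {t | i ∈ S ∧ l < ν i + t} = 1 := by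
    have hterm : ∀ i, F i {t | i ∈ S ∧ l < ν i + t} =
        if i ∈ S then ENNReal.ofReal ((F i).real (Ioi (l - ν i))) else 0 := by
      intro i
      split_ifs with hi
      · simp [hi, Ioi, sub_lt_iff_lt_add']
      · simp [hi]
    simp only [hterm]
    rw [Finset.sum_ite_mem, Finset.univ_inter,
      ← ENNReal.ofReal_sum_of_nonneg fun _ _ => measureReal_nonneg, hl, ENNReal.ofReal_one]
  have hmeas : ∀ i, MeasurableSet {t : ℝ | i ∈ S ∧ l < ν i + t} := fun i =>
    (MeasurableSet.const (i ∈ S)).inter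
      (measurableSet_lt (measurable_const (a := l)) (measurable_id.const_add (ν i)))
  obtain ⟨θ, hmap, hae⟩ := exists_coupling_existsUnique_mem hmeas hsum
  obtain ⟨i, -⟩ : S.Nonempty := by
    by_contra hS
    simp [Finset.not_nonempty_iff_eq_empty.1 hS] at hl
  refine ⟨θ, ⟨?_, hmap⟩, hae⟩
  have : IsProbabilityMeasure (θ.map (Function.eval i)) := hmap i ▸ inferInstance
  exact Measure.isProbabilityMeasure_of_map (Function.eval i)

theorem exists_expectedMaxUtility_eq_thresholdBound [∀ i, IsProbabilityMeasure (F i)]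
    (hF : ∀ i, Integrable (fun t : ℝ => t) (F i))
    (hl : ∑ i ∈ S, (F i).real (Ioi (l - ν i)) = 1) :
    ∃ θ ∈ jointLaws F, expectedMaxUtility ν S θ = thresholdBound ν F S l := by
  obtain ⟨θ, hθ, hae⟩ := exists_mem_jointLaws_ae_existsUnique hl
  refine ⟨θ, hθ, ?_⟩
  rw [← integral_add_sum_posPart hF hθ ν S l, expectedMaxUtility]
  refine integral_congr_ae ?_
  filter_upwards [hae] with ε hε
  exact iSup_eq_add_sum_posPart hε

theorem isMDMChoice_iff [∀ i, IsProbabilityMeasure (F i)] [∀ i, NullSingletonClass (F i)]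
    (hF : ∀ i, Integrable (fun t : ℝ => t) (F i))
    (hl : ∑ i ∈ S, (F i).real (Ioi (l - ν i)) = 1) {q : Fin n → ℝ} :
    IsMDMChoice ν F S q ↔ ∀ i ∈ S, q i = (F i).real (Ioi (l - ν i)) := by
  have hS : S.Nonempty := by
    by_contra hS
    simp [Finset.not_nonempty_iff_eq_empty.1 hS] at hl
  obtain ⟨θ₀, hθ₀, h₀⟩ := exists_expectedMaxUtility_eq_thresholdBound hF hl
  constructor
  · rintro ⟨θ, hθ, hmax, hq⟩ i hi
    have hopt : expectedMaxUtility ν S θ = thresholdBound ν F S l :=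
      le_antisymm (expectedMaxUtility_le_thresholdBound hF hθ ν hS l) (h₀ ▸ hmax hθ₀)
    rw [hq i hi, choiceProb_eq_of_expectedMaxUtility_eq hF hθ hopt hi]
  · intro hq
    refine ⟨θ₀, hθ₀, fun θ hθ => ?_, fun i hi => ?_⟩
    · exact (expectedMaxUtility_le_thresholdBound hF hθ ν hS l).trans_eq h₀.symm
    · rw [hq i hi, choiceProb_eq_of_expectedMaxUtility_eq hF hθ₀ h₀ hi]

end OptimalCoupling

/-! ### Survival functions -/

section SurvivalFunction

variable {μ : Measure ℝ} [IsProbabilityMeasure μ]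

lemma measureReal_Ioi_eq_one_sub_cdf (x : ℝ) : μ.real (Ioi x) = 1 - cdf μ x := by
  rw [cdf_eq_real, ← compl_Iic, probReal_compl_eq_one_sub measurableSet_Iic]

lemma continuous_measureReal_Ioi [NullSingletonClass μ] : Continuous fun x => μ.real (Ioi x) := by
  simp only [measureReal_Ioi_eq_one_sub_cdf]
  refine continuous_const.sub (continuous_iff_continuousAt.2 fun x => ?_)
  rw [(cdf μ).mono.continuousAt_iff_leftLim_eq_rightLim, StieltjesFunction.rightLim_eq]
  refine le_antisymm ((cdf μ).mono.leftLim_le le_rfl) ?_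
  have hnull : (cdf μ).measure {x} = 0 := by rw [measure_cdf, measure_singleton]
  rwa [StieltjesFunction.measure_singleton, ENNReal.ofReal_eq_zero, sub_nonpos] at hnull

lemma tendsto_measureReal_Ioi_atTop :
    Filter.Tendsto (fun x => μ.real (Ioi x)) Filter.atTop (nhds 0) := by
  simp only [measureReal_Ioi_eq_one_sub_cdf]
  simpa using (tendsto_cdf_atTop μ).const_sub 1

lemma cdf_eq_of_measure_Ioc_eq_zero {x y : ℝ} (hxy : x ≤ y) (h : μ (Ioc x y) = 0) :
    cdf μ x = cdf μ y := by
  rw [cdf_eq_real, cdf_eq_real, ← Iic_union_Ioc_eq_Iic hxy]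
  exact (measureReal_congr (union_ae_eq_left_of_ae_eq_empty (ae_eq_empty.2 h))).symm

lemma exists_mem_support_le_cdf_eq {x : ℝ} (hx : 0 < cdf μ x) :
    ∃ y ∈ μ.support, y ≤ x ∧ cdf μ y = cdf μ x := by
  have hpos : 0 < μ (Iic x) := by
    rw [cdf_eq_real] at hx
    exact pos_iff_ne_zero.2 fun h => by simp [measureReal_def, h] at hx
  have hbdd : BddAbove (Iic x ∩ μ.support) := ⟨x, fun z hz => hz.1⟩
  obtain ⟨hle, hmem⟩ := (isClosed_Iic.inter Measure.isClosed_support).csSup_mem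
    (Measure.nonempty_inter_support_of_pos hpos) hbdd
  refine ⟨_, hmem, hle, cdf_eq_of_measure_Ioc_eq_zero hle ?_⟩
  exact measure_mono_null (fun z hz hzs => hz.1.not_ge (le_csSup hbdd ⟨hz.2, hzs⟩))
    Measure.measure_compl_support

lemma exists_mem_support_ge_cdf_eq [NullSingletonClass μ] {x : ℝ} (hx : cdf μ x < 1) :
    ∃ y ∈ μ.support, x ≤ y ∧ cdf μ y = cdf μ x := by
  have hpos : 0 < μ (Ici x) := by
    rw [← sub_pos, ← measureReal_Ioi_eq_one_sub_cdf,
      measureReal_congr Ioi_ae_eq_Ici] at hx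
    exact pos_iff_ne_zero.2 fun h => by simp [measureReal_def, h] at hx
  have hbdd : BddBelow (Ici x ∩ μ.support) := ⟨x, fun z hz => hz.1⟩
  obtain ⟨hle, hmem⟩ := (isClosed_Ici.inter Measure.isClosed_support).csInf_mem
    (Measure.nonempty_inter_support_of_pos hpos) hbdd
  refine ⟨_, hmem, hle, (cdf_eq_of_measure_Ioc_eq_zero hle ?_).symm⟩
  rw [← measure_congr Ioo_ae_eq_Ioc]
  exact measure_mono_null (fun z hz hzs => hz.2.not_ge (csInf_le hbdd ⟨hz.1.le, hzs⟩))
    Measure.measure_compl_support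

lemma injOn_cdf_of_strictMonoOn_support [NullSingletonClass μ]
    (h : StrictMonoOn (cdf μ) μ.support) : InjOn (cdf μ) (cdf μ ⁻¹' Ioo 0 1) := by
  suffices hlt : ∀ x y, x < y → 0 < cdf μ x → cdf μ y < 1 → cdf μ x ≠ cdf μ y by
    intro x hx y hy hxy
    by_contra hne
    rcases lt_or_gt_of_ne hne with hlt' | hlt'
    exacts [hlt x y hlt' hx.1 hy.2 hxy, hlt y x hlt' hy.1 hx.2 hxy.symm]
  intro x y hxy hx hy heq
  obtain ⟨x', hx', hx'le, hx'eq⟩ := exists_mem_support_le_cdf_eq hx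
  obtain ⟨y', hy', hy'le, hy'eq⟩ := exists_mem_support_ge_cdf_eq hy
  have := h hx' hy' (hx'le.trans_lt (hxy.trans_le hy'le))
  linarith

end SurvivalFunction

/-! ### Survival curves and their thresholds -/

/-- `f` behaves on `T` like a survival function: it is decreasing with values in `[0, 1]` and can
only be constant where it is `0` or `1`. -/
structure IsSurvivalOn (f : ℝ → ℝ) (T : Set ℝ) : Prop where
  mapsTo : MapsTo f T (Icc 0 1)
  antitoneOn : AntitoneOn f T
  injOn : InjOn f (T ∩ f ⁻¹' Ioo 0 1)

/-- A continuous survival function `t ↦ P(X > t)` of a random variable that is bounded below and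
has a strictly increasing distribution function on its support. Being bounded below makes the value
`1` attained, so that every sum of survival curves crosses the level `1`. -/
structure IsSurvivalCurve (G : ℝ → ℝ) : Prop extends IsSurvivalOn G univ where
  continuous : Continuous G
  exists_eq_one : ∃ t, G t = 1
  tendsto_atTop : Filter.Tendsto G Filter.atTop (nhds 0)

namespace IsSurvivalCurve

variable {G : ℝ → ℝ}

lemma nonneg (hG : IsSurvivalCurve G) (t : ℝ) : 0 ≤ G t := (hG.mapsTo (mem_univ t)).1

lemma le_one (hG : IsSurvivalCurve G) (t : ℝ) : G t ≤ 1 := (hG.mapsTo (mem_univ t)).2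

lemma antitone (hG : IsSurvivalCurve G) : Antitone G := antitoneOn_univ.1 hG.antitoneOn

end IsSurvivalCurve

section Family

variable {ι : Type*} {G : ι → ℝ → ℝ} {S : Finset ι}

lemma continuous_sum_survivalCurve (hG : ∀ i, IsSurvivalCurve (G i)) (S : Finset ι) :
    Continuous fun t => ∑ i ∈ S, G i t :=
  continuous_finsetSum _ fun i _ => (hG i).continuous

lemma tendsto_sum_survivalCurve_atTop (hG : ∀ i, IsSurvivalCurve (G i)) (S : Finset ι) :
    Filter.Tendsto (fun t => ∑ i ∈ S, G i t) Filter.atTop (nhds 0) := by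
  simpa using tendsto_finsetSum S fun i _ => (hG i).tendsto_atTop

lemma exists_sum_survivalCurve_eq_one (hG : ∀ i, IsSurvivalCurve (G i)) (hS : S.Nonempty) :
    ∃ t, ∑ i ∈ S, G i t = 1 := by
  obtain ⟨b, hb⟩ := ((tendsto_sum_survivalCurve_atTop hG S).eventually
    (eventually_le_nhds zero_lt_one)).exists
  obtain ⟨i, hi⟩ := hS
  obtain ⟨a, ha⟩ := (hG i).exists_eq_one
  exact mem_range_of_exists_le_of_exists_ge (continuous_sum_survivalCurve hG S) ⟨b, hb⟩
    ⟨a, ha ▸ Finset.single_le_sum (f := fun i => G i a) (fun j _ => (hG j).nonneg a) hi⟩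

lemma exists_isGreatest_sum_survivalCurve_eq_one (hG : ∀ i, IsSurvivalCurve (G i))
    (hS : S.Nonempty) : ∃ t, IsGreatest {t | ∑ i ∈ S, G i t = 1} t := by
  have hclosed : IsClosed {t | ∑ i ∈ S, G i t = 1} :=
    isClosed_eq (continuous_sum_survivalCurve hG S) continuous_const
  obtain ⟨b, hb⟩ := Filter.eventually_atTop.1
    ((tendsto_sum_survivalCurve_atTop hG S).eventually (eventually_lt_nhds zero_lt_one))
  have hbdd : BddAbove {t | ∑ i ∈ S, G i t = 1} :=
    ⟨b, fun t ht => not_lt.1 fun hbt => (hb t hbt.le).ne ht⟩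
  exact ⟨_, hclosed.isGreatest_csSup (exists_sum_survivalCurve_eq_one hG hS) hbdd⟩

lemma le_of_isGreatest_of_survivalCurve_eq (hG : ∀ i, IsSurvivalCurve (G i)) {t b : ℝ}
    (ht : IsGreatest {t | ∑ i ∈ S, G i t = 1} t) {i : ι} (hi : i ∈ S) (h : G i t = G i b)
    (h0 : G i b ≠ 0) : b ≤ t := by
  classical
  by_contra! htb
  rcases ((hG i).le_one t).lt_or_eq with h1 | h1
  · have hIoo : G i b ∈ Ioo 0 1 := ⟨((hG i).nonneg b).lt_of_ne' h0, h ▸ h1⟩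
    exact htb.ne
      ((hG i).injOn ⟨mem_univ t, mem_preimage.2 (h.symm ▸ hIoo)⟩ ⟨mem_univ b, hIoo⟩ h)
  · refine htb.not_ge (ht.2 (?_ : ∑ j ∈ S, G j b = 1))
    have hsum : ∑ j ∈ S, G j t = 1 := ht.1
    rw [← Finset.add_sum_erase _ _ hi, h1] at hsum
    have hzero := (Finset.sum_eq_zero_iff_of_nonneg fun j _ => (hG j).nonneg t).1
      (by linarith : ∑ j ∈ S.erase i, G j t = 0)
    rw [← Finset.add_sum_erase _ _ hi, ← h, h1, Finset.sum_eq_zero, add_zero]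
    exact fun j hj => le_antisymm (hzero j hj ▸ (hG j).antitone htb.le) ((hG j).nonneg b)

/-- The order conditions on the multipliers `lam` that characterize when the choice probabilities
`p` over `𝒮` are representable by a marginal distribution model. -/
structure IsOrderCompatible (𝒮 : Finset (Finset ι)) (p : Finset ι → ι → ℝ)
    (lam : Finset ι → ℝ) : Prop where
  lam_lt : ∀ S ∈ 𝒮, ∀ T ∈ 𝒮, ∀ i, i ∈ S → i ∈ T → p S i < p T i → lam T < lam S
  lam_eq : ∀ S ∈ 𝒮, ∀ T ∈ 𝒮, ∀ i, i ∈ S → i ∈ T → p S i = p T i → p S i ≠ 0 → lam S = lam T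

-- Thresholds are not unique where curves are flat; the greatest ones are order compatible.
theorem exists_isOrderCompatible_of_survivalCurve {𝒮 : Finset (Finset ι)} {p : Finset ι → ι → ℝ}
    (hG : ∀ i, IsSurvivalCurve (G i))
    (hp : ∀ S ∈ 𝒮, ∃ t, ∑ i ∈ S, G i t = 1 ∧ ∀ i ∈ S, p S i = G i t) :
    ∃ lam, IsOrderCompatible 𝒮 p lam := by
  have hgreatest : ∀ S ∈ 𝒮, ∃ t, IsGreatest {t | ∑ i ∈ S, G i t = 1} t ∧
      ∀ i ∈ S, p S i = G i t := by
    intro S hS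
    obtain ⟨t, ht, hpt⟩ := hp S hS
    have hne : S.Nonempty := Finset.nonempty_of_sum_ne_zero (ht.trans_ne one_ne_zero)
    obtain ⟨l, hl⟩ := exists_isGreatest_sum_survivalCurve_eq_one hG hne
    have hlt : ∀ i ∈ S, G i l = G i t := (Finset.sum_eq_sum_iff_of_le
      fun i _ => (hG i).antitone (hl.2 ht)).1 (hl.1.trans ht.symm)
    exact ⟨l, hl, fun i hi => (hpt i hi).trans (hlt i hi).symm⟩
  choose! lam hlam hval using hgreatest
  refine ⟨lam, fun S hS T hT i hiS hiT hlt => ?_, fun S hS T hT i hiS hiT heq hne => ?_⟩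
  · rw [hval S hS i hiS, hval T hT i hiT] at hlt
    exact (hG i).antitone.reflect_lt hlt
  · rw [hval S hS i hiS] at heq hne
    rw [hval T hT i hiT] at heq
    exact le_antisymm
      (le_of_isGreatest_of_survivalCurve_eq hG (hlam T hT) hiT heq.symm hne)
      (le_of_isGreatest_of_survivalCurve_eq hG (hlam S hS) hiS heq (heq ▸ hne))

end Family

/-! ### Representable data are order compatible -/

/-- The survival function of the utility `c + ε` on the exponential scale, `u ↦ P(exp (c + ε) > u)`,
where `ε` has law `μ`. On this scale the utility is bounded below, whatever the law. -/
noncomputable def utilitySurvival (μ : Measure ℝ) (c u : ℝ) : ℝ :=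
  μ.real {t | u < Real.exp (c + t)}

section UtilitySurvival

variable {μ : Measure ℝ} {c u : ℝ}

lemma utilitySurvival_of_nonpos [IsProbabilityMeasure μ] (hu : u ≤ 0) :
    utilitySurvival μ c u = 1 := by
  have huniv : {t | u < Real.exp (c + t)} = univ :=
    eq_univ_of_forall fun t => hu.trans_lt (Real.exp_pos _)
  rw [utilitySurvival, huniv, probReal_univ]

lemma utilitySurvival_of_pos (hu : 0 < u) :
    utilitySurvival μ c u = μ.real (Ioi (Real.log u - c)) := by
  simp only [utilitySurvival, Ioi, sub_lt_iff_lt_add', Real.log_lt_iff_lt_exp hu]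

lemma utilitySurvival_eq_measureReal_map :
    utilitySurvival μ c u = (μ.map fun t => Real.exp (c + t)).real (Ioi u) := by
  rw [map_measureReal_apply (by fun_prop) measurableSet_Ioi]
  rfl

lemma nullSingletonClass_map_of_injective {f : ℝ → ℝ} [NullSingletonClass μ] (hf : Measurable f)
    (hinj : Function.Injective f) : NullSingletonClass (μ.map f) where
  measure_singleton x := by
    rw [Measure.map_apply hf (measurableSet_singleton x)]
    exact (subsingleton_singleton.preimage hinj).measure_zero μ

lemma isSurvivalCurve_utilitySurvival_of_strictMonoOn_cdf [IsProbabilityMeasure μ]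
    [NullSingletonClass μ] (h : StrictMonoOn (cdf μ) μ.support) (c : ℝ) :
    IsSurvivalCurve (utilitySurvival μ c) where
  mapsTo _ _ := ⟨measureReal_nonneg, measureReal_le_one⟩
  antitoneOn _ _ _ _ hab := measureReal_mono fun _ ht => hab.trans_lt ht
  injOn := by
    have hpos : ∀ a ∈ utilitySurvival μ c ⁻¹' Ioo 0 1, 0 < a := fun a ha =>
      not_le.1 fun hle => ha.2.ne (utilitySurvival_of_nonpos hle)
    rintro a ⟨-, ha⟩ b ⟨-, hb⟩ hab
    have ha0 := hpos a ha
    have hb0 := hpos b hb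
    simp only [mem_preimage, utilitySurvival_of_pos, ha0, hb0, measureReal_Ioi_eq_one_sub_cdf,
      mem_Ioo, sub_pos, sub_lt_self_iff, sub_right_inj] at ha hb hab
    have := injOn_cdf_of_strictMonoOn_support h ha.symm hb.symm hab
    exact Real.log_injOn_pos ha0 hb0 (sub_left_injective this)
  continuous := by
    have hmeas : Measurable fun t => Real.exp (c + t) := by fun_prop
    have := Measure.isProbabilityMeasure_map (μ := μ) hmeas.aemeasurable
    have := nullSingletonClass_map_of_injective (μ := μ) hmeas
      (Real.exp_injective.comp (add_right_injective c))
    exact (continuous_measureReal_Ioi (μ := μ.map fun t => Real.exp (c + t))).congr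
      fun u => utilitySurvival_eq_measureReal_map.symm
  exists_eq_one := ⟨0, utilitySurvival_of_nonpos le_rfl⟩
  tendsto_atTop := by
    have := Measure.isProbabilityMeasure_map (μ := μ)
      (f := fun t => Real.exp (c + t)) (by fun_prop)
    exact tendsto_measureReal_Ioi_atTop.congr fun u => utilitySurvival_eq_measureReal_map.symm

end UtilitySurvival

lemma IsAdmissibleMarginal.nullSingletonClass {μ : Measure ℝ} (hμ : IsAdmissibleMarginal μ) :
    NullSingletonClass μ :=
  ⟨fun _ => hμ.absolutelyContinuous Real.volume_singleton⟩

lemma IsAdmissibleMarginal.isSurvivalCurve_utilitySurvival {μ : Measure ℝ}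
    (hμ : IsAdmissibleMarginal μ) (c : ℝ) : IsSurvivalCurve (utilitySurvival μ c) := by
  have := hμ.isProbabilityMeasure
  have := hμ.nullSingletonClass
  exact isSurvivalCurve_utilitySurvival_of_strictMonoOn_cdf hμ.strictMonoOn_cdf c

section Forward

variable {n : ℕ} {ν : Fin n → ℝ} {F : Fin n → Measure ℝ} {S : Finset (Fin n)} {q : Fin n → ℝ}

lemma IsMDMChoice.exists_eq_utilitySurvival (hF : ∀ i, IsAdmissibleMarginal (F i))
    (hq : IsMDMChoice ν F S q) (hsum : ∑ i ∈ S, q i = 1) :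
    ∃ t, ∑ i ∈ S, utilitySurvival (F i) (ν i) t = 1 ∧
      ∀ i ∈ S, q i = utilitySurvival (F i) (ν i) t := by
  have := fun i => (hF i).isProbabilityMeasure
  have := fun i => (hF i).nullSingletonClass
  obtain ⟨t, ht⟩ := exists_sum_survivalCurve_eq_one
    (fun i => (hF i).isSurvivalCurve_utilitySurvival (ν i))
    (Finset.nonempty_of_sum_ne_zero (hsum.trans_ne one_ne_zero))
  refine ⟨t, ht, ?_⟩
  rcases le_or_gt t 0 with hle | hpos
  · have hcard : S.card = 1 := by
      simpa [utilitySurvival_of_nonpos hle] using ht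
    obtain ⟨i, rfl⟩ := Finset.card_eq_one.1 hcard
    simpa [utilitySurvival_of_nonpos hle] using hsum
  · simp only [utilitySurvival_of_pos hpos] at ht ⊢
    exact (isMDMChoice_iff (fun i => (hF i).integrable) ht).1 hq

theorem IsMDMRepresentable.exists_isOrderCompatible {𝒮 : Finset (Finset (Fin n))}
    {p : Finset (Fin n) → Fin n → ℝ} (hp : IsMDMRepresentable 𝒮 p) :
    ∃ lam, IsOrderCompatible 𝒮 p lam := by
  obtain ⟨hcol, ν, F, hF, hchoice⟩ := hp
  exact exists_isOrderCompatible_of_survivalCurve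
    (fun i => (hF i).isSurvivalCurve_utilitySurvival (ν i))
    fun S hS => (hchoice S hS).exists_eq_utilitySurvival hF (hcol S hS).2

end Forward

/-! ### Interpolation by bilipschitz decreasing functions -/

/-- `H` is decreasing, with all difference quotients between two negative constants. This is
expressed by tilting `H` into a Lipschitz function with constant smaller than the slope `m` of the
tilt, so that the extension theorem for real Lipschitz functions applies. -/
def IsBilipschitzAnti (H : ℝ → ℝ) : Prop :=
  ∃ (m : ℝ) (r : NNReal), r < m ∧ LipschitzWith r fun x => H x + m * x

namespace IsBilipschitzAnti

variable {H : ℝ → ℝ}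

lemma exists_lipschitzWith (hH : IsBilipschitzAnti H) : ∃ C, LipschitzWith C H := by
  obtain ⟨m, r, -, hr⟩ := hH
  exact ⟨_, by simpa using hr.sub (lipschitzWith_smul m)⟩

lemma continuous (hH : IsBilipschitzAnti H) : Continuous H :=
  hH.exists_lipschitzWith.choose_spec.continuous

lemma exists_mul_sub_le (hH : IsBilipschitzAnti H) :
    ∃ δ > 0, ∀ x y, x ≤ y → δ * (y - x) ≤ H x - H y := by
  obtain ⟨m, r, hrm, hr⟩ := hH
  refine ⟨m - r, sub_pos.2 hrm, fun x y hxy => ?_⟩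
  have hdist := hr.dist_le_mul y x
  rw [Real.dist_eq, Real.dist_eq, abs_of_nonneg (sub_nonneg.2 hxy)] at hdist
  linarith [le_abs_self (H y + m * y - (H x + m * x))]

lemma strictAnti (hH : IsBilipschitzAnti H) : StrictAnti H := by
  obtain ⟨δ, hδ, h⟩ := hH.exists_mul_sub_le
  intro x y hxy
  linarith [h x y hxy.le, mul_pos hδ (sub_pos.2 hxy)]

lemma tendsto_atTop (hH : IsBilipschitzAnti H) : Filter.Tendsto H Filter.atTop Filter.atBot := by
  obtain ⟨δ, hδ, h⟩ := hH.exists_mul_sub_le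
  have hlin : Filter.Tendsto (fun x => H 0 + -δ * x) Filter.atTop Filter.atBot :=
    Filter.tendsto_atBot_add_const_left _ _
      (Filter.tendsto_id.const_mul_atTop_of_neg (neg_neg_of_pos hδ))
  refine Filter.tendsto_atBot_mono' _ ?_ hlin
  filter_upwards [Filter.eventually_ge_atTop 0] with x hx
  linarith [h 0 x hx]

lemma tendsto_atBot (hH : IsBilipschitzAnti H) : Filter.Tendsto H Filter.atBot Filter.atTop := by
  obtain ⟨δ, hδ, h⟩ := hH.exists_mul_sub_le
  have hlin : Filter.Tendsto (fun x => H 0 + -δ * x) Filter.atBot Filter.atTop :=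
    Filter.tendsto_atTop_add_const_left _ _
      (Filter.tendsto_id.const_mul_atBot_of_neg (neg_neg_of_pos hδ))
  refine Filter.tendsto_atTop_mono' _ ?_ hlin
  filter_upwards [Filter.eventually_le_atBot 0] with x hx
  linarith [h x 0 hx]

lemma surjective (hH : IsBilipschitzAnti H) : Function.Surjective H :=
  hH.continuous.surjective' hH.tendsto_atBot hH.tendsto_atTop

end IsBilipschitzAnti

lemma exists_mul_sub_le_of_strictAntiOn {h : ℝ → ℝ} {T : Set ℝ} (hT : T.Finite)
    (hh : StrictAntiOn h T) :
    ∃ δ > 0, ∃ m > δ, ∀ x ∈ T, ∀ y ∈ T, x < y →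
      δ * (y - x) ≤ h x - h y ∧ h x - h y ≤ m * (y - x) := by
  have hlower : ∀ᶠ δ in nhdsWithin (0 : ℝ) (Ioi 0), ∀ x ∈ T, ∀ y ∈ T, x < y →
      δ * (y - x) ≤ h x - h y := by
    simp only [Filter.eventually_all_finite hT, Filter.eventually_imp_distrib_left]
    intro x hx y hy hxy
    have hslope : 0 < (h x - h y) / (y - x) :=
      div_pos (sub_pos.2 (hh hx hy hxy)) (sub_pos.2 hxy)
    filter_upwards [Ioc_mem_nhdsGT hslope] with δ hδ
    exact (le_div_iff₀ (sub_pos.2 hxy)).1 hδ.2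
  have hupper : ∀ᶠ m in Filter.atTop, ∀ x ∈ T, ∀ y ∈ T, x < y → h x - h y ≤ m * (y - x) := by
    simp only [Filter.eventually_all_finite hT, Filter.eventually_imp_distrib_left]
    intro x _ y _ hxy
    filter_upwards [Filter.eventually_ge_atTop ((h x - h y) / (y - x))] with m hm
    exact (div_le_iff₀ (sub_pos.2 hxy)).1 hm
  obtain ⟨δ, hδ, hδpos⟩ := (hlower.and self_mem_nhdsWithin).exists
  obtain ⟨m, hm, hmδ⟩ := (hupper.and (Filter.eventually_gt_atTop δ)).exists
  exact ⟨δ, hδpos, m, hmδ, fun x hx y hy hxy => ⟨hδ x hx y hy hxy, hm x hx y hy hxy⟩⟩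

theorem exists_isBilipschitzAnti_eqOn {h : ℝ → ℝ} {T : Set ℝ} (hT : T.Finite)
    (hh : StrictAntiOn h T) : ∃ H, IsBilipschitzAnti H ∧ EqOn H h T := by
  obtain ⟨δ, hδ, m, hδm, hbounds⟩ := exists_mul_sub_le_of_strictAntiOn hT hh
  have hlip : LipschitzOnWith (m - δ).toNNReal (fun x => h x + m * x) T := by
    refine LipschitzOnWith.of_dist_le_mul fun x hx y hy => ?_
    rw [Real.coe_toNNReal _ (sub_nonneg.2 hδm.le)]
    wlog hxy : x < y generalizing x y
    · rcases (not_lt.1 hxy).eq_or_lt with rfl | hyx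
      · simp
      · simpa only [dist_comm] using this y hy x hx hyx
    obtain ⟨hlow, hup⟩ := hbounds x hx y hy hxy
    have hpos := mul_pos (sub_pos.2 hδm) (sub_pos.2 hxy)
    rw [Real.dist_eq, Real.dist_eq, abs_sub_comm x, abs_of_pos (sub_pos.2 hxy), abs_le]
    constructor <;> linarith
  obtain ⟨K, hK, hKh⟩ := hlip.extend_real
  refine ⟨fun x => K x - m * x, ⟨m, (m - δ).toNNReal, ?_, by simpa using hK⟩, fun x hx => ?_⟩
  · rw [Real.coe_toNNReal _ (sub_nonneg.2 hδm.le)]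
    linarith
  · exact sub_eq_of_eq_add (hKh hx).symm

/-- Truncation of a real number to the unit interval, as in `Set.projIcc` but with values in `ℝ`. -/
noncomputable def clampUnit (v : ℝ) : ℝ := max (min 1 v) 0

lemma clampUnit_mem_Icc (v : ℝ) : clampUnit v ∈ Icc 0 1 :=
  ⟨le_max_right _ _, max_le (min_le_left _ _) zero_le_one⟩

lemma clampUnit_of_nonpos {v : ℝ} (hv : v ≤ 0) : clampUnit v = 0 :=
  max_eq_right ((min_le_right _ _).trans hv)

lemma clampUnit_of_one_le {v : ℝ} (hv : 1 ≤ v) : clampUnit v = 1 := by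
  rw [clampUnit, min_eq_left hv, max_eq_left zero_le_one]

lemma clampUnit_of_mem_Icc {v : ℝ} (hv : v ∈ Icc 0 1) : clampUnit v = v := by
  rw [clampUnit, min_eq_right hv.2, max_eq_left hv.1]

lemma clampUnit_eq_self_of_mem_Ioo {v : ℝ} (hv : clampUnit v ∈ Ioo 0 1) : clampUnit v = v := by
  refine clampUnit_of_mem_Icc ⟨?_, ?_⟩ <;> by_contra! hlt
  · exact hv.1.ne' (clampUnit_of_nonpos hlt.le)
  · exact hv.2.ne (clampUnit_of_one_le hlt.le)

lemma monotone_clampUnit : Monotone clampUnit := fun _ _ h =>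
  max_le_max_right _ (min_le_min_left _ h)

lemma continuous_clampUnit : Continuous clampUnit :=
  (continuous_const.min continuous_id).max continuous_const

lemma IsBilipschitzAnti.isSurvivalCurve_clampUnit {H : ℝ → ℝ} (hH : IsBilipschitzAnti H) :
    IsSurvivalCurve fun t => clampUnit (H t) where
  mapsTo t _ := clampUnit_mem_Icc (H t)
  antitoneOn _ _ _ _ hab := monotone_clampUnit (hH.strictAnti.antitone hab)
  injOn a ha b hb hab := by
    refine hH.strictAnti.injective ?_
    rw [← clampUnit_eq_self_of_mem_Ioo ha.2, ← clampUnit_eq_self_of_mem_Ioo hb.2]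
    exact hab
  continuous := continuous_clampUnit.comp hH.continuous
  exists_eq_one := (hH.surjective 1).imp fun _ ht => clampUnit_of_one_le ht.ge
  tendsto_atTop := tendsto_const_nhds.congr' <|
    (hH.tendsto_atTop.eventually_le_atBot 0).mono fun _ ht => (clampUnit_of_nonpos ht).symm

lemma IsSurvivalOn.exists_strictAntiOn_clampUnit {f : ℝ → ℝ} {T : Set ℝ} (hf : IsSurvivalOn f T)
    (hT : T.Finite) : ∃ h, StrictAntiOn h T ∧ ∀ x ∈ T, clampUnit (h x) = f x := by
  obtain ⟨c, hc⟩ := hT.bddBelow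
  obtain ⟨d, hd⟩ := hT.bddAbove
  let h : ℝ → ℝ := fun x => if f x = 0 then c - x else if f x = 1 then 1 + (d - x) else f x
  have hzero : ∀ {x}, f x = 0 → h x = c - x := fun hx => if_pos hx
  have hone : ∀ {x}, f x = 1 → h x = 1 + (d - x) := fun hx => by simp [h, hx]
  have hmid : ∀ {x}, f x ≠ 0 → f x ≠ 1 → h x = f x := fun h0 h1 => by simp [h, h0, h1]
  have hle : ∀ x ∈ T, f x ≠ 1 → h x ≤ f x := by
    intro x hx h1
    by_cases h0 : f x = 0
    · linarith [hzero h0, hc hx]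
    · exact (hmid h0 h1).le
  have hge : ∀ x ∈ T, f x ≠ 0 → f x ≤ h x := by
    intro x hx h0
    by_cases h1 : f x = 1
    · linarith [hone h1, hd hx]
    · exact (hmid h0 h1).ge
  refine ⟨h, fun x hx y hy hxy => ?_, fun x hx => ?_⟩
  · have hx01 := hf.mapsTo hx
    have hy01 := hf.mapsTo hy
    rcases (hf.antitoneOn hx hy hxy.le).eq_or_lt with heq | hlt
    · by_cases h0 : f x = 0
      · linarith [hzero h0, hzero (heq.trans h0)]
      by_cases h1 : f x = 1
      · linarith [hone h1, hone (heq.trans h1)]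
      have hIoo : f x ∈ Ioo 0 1 := ⟨hx01.1.lt_of_ne' h0, hx01.2.lt_of_ne h1⟩
      exact absurd (hf.injOn ⟨hx, hIoo⟩ ⟨hy, mem_preimage.2 (heq ▸ hIoo)⟩ heq.symm) hxy.ne
    · exact (hle y hy (hlt.trans_le hx01.2).ne).trans_lt
        (hlt.trans_le (hge x hx (hy01.1.trans_lt hlt).ne'))
  · by_cases h0 : f x = 0
    · rw [clampUnit_of_nonpos ((hle x hx (by simp [h0])).trans_eq h0), h0]
    by_cases h1 : f x = 1
    · rw [clampUnit_of_one_le (h1.ge.trans (hge x hx h0)), h1]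
    · rw [hmid h0 h1, clampUnit_of_mem_Icc (hf.mapsTo hx)]

theorem IsSurvivalOn.exists_isBilipschitzAnti {f : ℝ → ℝ} {T : Set ℝ} (hf : IsSurvivalOn f T)
    (hT : T.Finite) : ∃ H, IsBilipschitzAnti H ∧ ∀ x ∈ T, clampUnit (H x) = f x := by
  obtain ⟨h, hh, hhf⟩ := hf.exists_strictAntiOn_clampUnit hT
  obtain ⟨H, hH, hHh⟩ := exists_isBilipschitzAnti_eqOn hT hh
  exact ⟨H, hH, fun x hx => by rw [hHh hx, hhf x hx]⟩

lemma IsSurvivalOn.exists_isSurvivalCurve {f : ℝ → ℝ} {T : Set ℝ} (hf : IsSurvivalOn f T)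
    (hT : T.Finite) : ∃ G, IsSurvivalCurve G ∧ EqOn G f T := by
  obtain ⟨H, hH, hHf⟩ := hf.exists_isBilipschitzAnti hT
  exact ⟨_, hH.isSurvivalCurve_clampUnit, hHf⟩

/-! ### Marginal laws with prescribed survival functions -/

namespace IsBilipschitzAnti

variable {H : ℝ → ℝ}

/-- A decreasing bilipschitz function as a bijection, whose inverse is a quantile function. -/
noncomputable def equiv (hH : IsBilipschitzAnti H) : ℝ ≃ ℝ :=
  Equiv.ofBijective H ⟨hH.strictAnti.injective, hH.surjective⟩

/-- The law with survival function `x ↦ clampUnit (H x)`, obtained by applying the inverse of `H`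
to a uniform random variable on `(0, 1)`. -/
noncomputable def law (hH : IsBilipschitzAnti H) : Measure ℝ :=
  (volume.restrict (Ioo (0 : ℝ) 1)).map hH.equiv.symm

lemma lt_equiv_symm_iff (hH : IsBilipschitzAnti H) {x u : ℝ} :
    x < hH.equiv.symm u ↔ u < H x := by
  rw [← hH.strictAnti.lt_iff_gt]
  exact iff_of_eq (congrArg (· < H x) (hH.equiv.apply_symm_apply u))

lemma antitone_equiv_symm (hH : IsBilipschitzAnti H) : Antitone hH.equiv.symm := by
  intro u v huv
  by_contra! hlt
  rw [hH.lt_equiv_symm_iff] at hlt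
  exact (huv.trans_lt hlt).ne' (hH.equiv.apply_symm_apply u)

lemma measurable_equiv_symm (hH : IsBilipschitzAnti H) : Measurable hH.equiv.symm :=
  hH.antitone_equiv_symm.measurable

lemma isProbabilityMeasure_law (hH : IsBilipschitzAnti H) : IsProbabilityMeasure hH.law := by
  have : IsProbabilityMeasure (volume.restrict (Ioo (0 : ℝ) 1)) := ⟨by simp⟩
  exact Measure.isProbabilityMeasure_map hH.measurable_equiv_symm.aemeasurable

lemma law_real_Ioi (hH : IsBilipschitzAnti H) (x : ℝ) : hH.law.real (Ioi x) = clampUnit (H x) := by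
  have hpre : hH.equiv.symm ⁻¹' Ioi x = Iio (H x) := ext fun u => hH.lt_equiv_symm_iff
  rw [law, map_measureReal_apply hH.measurable_equiv_symm measurableSet_Ioi, hpre,
    measureReal_restrict_apply measurableSet_Iio, inter_comm, Ioo_inter_Iio,
    Real.volume_real_Ioo, sub_zero, clampUnit]

lemma absolutelyContinuous_law (hH : IsBilipschitzAnti H) : hH.law ≪ volume := by
  refine Measure.AbsolutelyContinuous.mk fun s hs hnull => ?_
  rw [law, Measure.map_apply hH.measurable_equiv_symm hs, ← hH.equiv.image_eq_preimage_symm]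
  refine Measure.absolutelyContinuous_of_le Measure.restrict_le_self ?_
  obtain ⟨C, hC⟩ := hH.exists_lipschitzWith
  have hle := (hC.lipschitzOnWith (s := s)).hausdorffMeasure_image_le (d := 1) zero_le_one
  rw [hausdorffMeasure_real, hnull, mul_zero] at hle
  exact nonpos_iff_eq_zero.1 hle

lemma ae_law_mem_Icc (hH : IsBilipschitzAnti H) : ∀ᵐ t ∂hH.law, H t ∈ Icc 0 1 := by
  have hmeas : MeasurableSet {t | H t ∈ Icc 0 1} := hH.continuous.measurable measurableSet_Icc
  rw [law, ae_map_iff hH.measurable_equiv_symm.aemeasurable hmeas]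
  filter_upwards [ae_restrict_mem measurableSet_Ioo] with u hu
  rw [show H (hH.equiv.symm u) = u from hH.equiv.apply_symm_apply u]
  exact Ioo_subset_Icc_self hu

lemma support_law_subset (hH : IsBilipschitzAnti H) : hH.law.support ⊆ H ⁻¹' Icc 0 1 :=
  Measure.support_subset_of_isClosed (isClosed_Icc.preimage hH.continuous) hH.ae_law_mem_Icc

lemma strictMonoOn_cdf_law (hH : IsBilipschitzAnti H) :
    StrictMonoOn (cdf hH.law) hH.law.support := by
  have := hH.isProbabilityMeasure_law
  have hcdf : ∀ z ∈ hH.law.support, 1 - cdf hH.law z = H z := fun z hz => by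
    rw [← measureReal_Ioi_eq_one_sub_cdf, hH.law_real_Ioi,
      clampUnit_of_mem_Icc (hH.support_law_subset hz)]
  intro x hx y hy hxy
  linarith [hcdf x hx, hcdf y hy, hH.strictAnti hxy]

lemma integrable_law (hH : IsBilipschitzAnti H) : Integrable (fun t => t) hH.law := by
  have := hH.isProbabilityMeasure_law
  obtain ⟨a, ha⟩ := hH.surjective 1
  obtain ⟨b, hb⟩ := hH.surjective 0
  refine Integrable.of_mem_Icc a b measurable_id.aemeasurable ?_
  filter_upwards [hH.ae_law_mem_Icc] with t ht
  exact ⟨hH.strictAnti.le_iff_ge.1 (ht.2.trans_eq ha.symm),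
    hH.strictAnti.le_iff_ge.1 (hb.trans_le ht.1)⟩

lemma isAdmissibleMarginal_law (hH : IsBilipschitzAnti H) : IsAdmissibleMarginal hH.law where
  isProbabilityMeasure := hH.isProbabilityMeasure_law
  absolutelyContinuous := hH.absolutelyContinuous_law
  strictMonoOn_cdf := hH.strictMonoOn_cdf_law
  integrable := hH.integrable_law

end IsBilipschitzAnti

/-! ### Order compatible data are representable -/

section OrderCompatible

variable {ι : Type*} {𝒮 : Finset (Finset ι)} {p : Finset ι → ι → ℝ} {lam : Finset ι → ℝ} {i : ι}

lemma IsOrderCompatible.le_of_lam_le (hlam : IsOrderCompatible 𝒮 p lam) {S T : Finset ι}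
    (hS : S ∈ 𝒮) (hT : T ∈ 𝒮) (hiS : i ∈ S) (hiT : i ∈ T) (hle : lam S ≤ lam T) :
    p T i ≤ p S i := by
  by_contra! hlt
  exact (hlam.lam_lt S hS T hT i hiS hiT hlt).not_ge hle

/-- The multipliers of the assortments in `𝒮` that contain `i`, at which a survival function of `i`
is prescribed. -/
def multiplierSet (𝒮 : Finset (Finset ι)) (lam : Finset ι → ℝ) (i : ι) : Set ℝ :=
  lam '' {S | S ∈ 𝒮 ∧ i ∈ S}

lemma finite_multiplierSet (𝒮 : Finset (Finset ι)) (lam : Finset ι → ℝ) (i : ι) :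
    (multiplierSet 𝒮 lam i).Finite :=
  (𝒮.finite_toSet.subset fun _ hS => hS.1).image lam

lemma mem_multiplierSet {S : Finset ι} (hS : S ∈ 𝒮) (hi : i ∈ S) :
    lam S ∈ multiplierSet 𝒮 lam i :=
  mem_image_of_mem lam ⟨hS, hi⟩

lemma IsOrderCompatible.exists_isSurvivalOn (hlam : IsOrderCompatible 𝒮 p lam)
    (hp : ∀ S ∈ 𝒮, i ∈ S → p S i ∈ Icc 0 1) :
    ∃ f, IsSurvivalOn f (multiplierSet 𝒮 lam i) ∧ ∀ S ∈ 𝒮, i ∈ S → f (lam S) = p S i := by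
  have hfactor : (fun S : {S // S ∈ 𝒮 ∧ i ∈ S} => p S i).FactorsThrough fun S => lam S := by
    rintro ⟨S, hS, hiS⟩ ⟨T, hT, hiT⟩ heq
    exact le_antisymm (hlam.le_of_lam_le hT hS hiT hiS heq.ge)
      (hlam.le_of_lam_le hS hT hiS hiT heq.le)
  obtain ⟨f, hf⟩ := (Function.factorsThrough_iff _).1 hfactor
  have hval : ∀ S ∈ 𝒮, i ∈ S → f (lam S) = p S i := fun S hS hi =>
    (congrFun hf ⟨S, hS, hi⟩).symm
  refine ⟨f, ⟨?_, ?_, ?_⟩, hval⟩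
  · rintro _ ⟨S, ⟨hS, hiS⟩, rfl⟩
    exact hval S hS hiS ▸ hp S hS hiS
  · rintro _ ⟨S, ⟨hS, hiS⟩, rfl⟩ _ ⟨T, ⟨hT, hiT⟩, rfl⟩ hle
    rw [hval S hS hiS, hval T hT hiT]
    exact hlam.le_of_lam_le hS hT hiS hiT hle
  · rintro _ ⟨⟨S, ⟨hS, hiS⟩, rfl⟩, hpos, -⟩ _ ⟨⟨T, ⟨hT, hiT⟩, rfl⟩, -⟩ heq
    rw [hval S hS hiS] at hpos heq
    rw [hval T hT hiT] at heq
    exact hlam.lam_eq S hS T hT i hiS hiT heq hpos.ne'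

end OrderCompatible

section Characterization

variable {n : ℕ} {𝒮 : Finset (Finset (Fin n))} {p : Finset (Fin n) → Fin n → ℝ}

lemma IsChoiceCollection.mem_Icc (hp : IsChoiceCollection 𝒮 p) {S : Finset (Fin n)} (hS : S ∈ 𝒮)
    {i : Fin n} (hi : i ∈ S) : p S i ∈ Icc 0 1 :=
  ⟨(hp S hS).1 i hi, (hp S hS).2 ▸ Finset.single_le_sum (hp S hS).1 hi⟩

theorem isMDMRepresentable_iff :
    IsMDMRepresentable 𝒮 p ↔ IsChoiceCollection 𝒮 p ∧ ∃ lam, IsOrderCompatible 𝒮 p lam := by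
  refine ⟨fun hp => ⟨hp.1, hp.exists_isOrderCompatible⟩, fun ⟨hcol, lam, hlam⟩ => ⟨hcol, ?_⟩⟩
  choose f hf hfp using fun i =>
    hlam.exists_isSurvivalOn (i := i) fun S hS hi => hcol.mem_Icc hS hi
  choose H hH hHf using fun i => (hf i).exists_isBilipschitzAnti (finite_multiplierSet 𝒮 lam i)
  have := fun i => (hH i).isProbabilityMeasure_law
  have := fun i => (hH i).isAdmissibleMarginal_law.nullSingletonClass
  refine ⟨0, fun i => (hH i).law, fun i => (hH i).isAdmissibleMarginal_law, fun S hS => ?_⟩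
  have hval : ∀ i ∈ S, p S i = (hH i).law.real (Ioi (lam S - (0 : Fin n → ℝ) i)) := by
    intro i hi
    rw [Pi.zero_apply, sub_zero, (hH i).law_real_Ioi, hHf i _ (mem_multiplierSet hS hi),
      hfp i S hS hi]
  exact (isMDMChoice_iff (fun i => (hH i).integrable_law)
    ((Finset.sum_congr rfl hval).symm.trans (hcol S hS).2)).2 hval

end Characterization

/-! ### Consistent vectors for a new assortment -/

section Extension

variable {n : ℕ} {𝒮 : Finset (Finset (Fin n))} {p : Finset (Fin n) → Fin n → ℝ}
  {A S : Finset (Fin n)} {x : A → ℝ} {lam : Finset (Fin n) → ℝ}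

lemma extendData_of_ne (h : S ≠ A) : extendData p A x S = p S := by
  funext i
  exact dif_neg fun hS => h hS.1

lemma extendData_self (i : A) : extendData p A x A i = x i := dif_pos ⟨rfl, i.2⟩

lemma isChoiceCollection_insert_extendData (hA𝒮 : A ∉ 𝒮) :
    IsChoiceCollection (insert A 𝒮) (extendData p A x) ↔
      ((∀ i, 0 ≤ x i) ∧ ∑ i, x i = 1) ∧ IsChoiceCollection 𝒮 p := by
  have hA : ∑ i ∈ A, extendData p A x A i = ∑ i, x i := by
    simp only [← Finset.sum_coe_sort A, extendData_self]
  have hnonneg : (∀ i ∈ A, 0 ≤ extendData p A x A i) ↔ ∀ i, 0 ≤ x i := by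
    simp only [← extendData_self (p := p) (x := x), Subtype.forall]
  rw [IsChoiceCollection, Finset.forall_mem_insert, hA, hnonneg]
  refine and_congr_right' (forall₂_congr fun S hS => ?_)
  rw [extendData_of_ne (ne_of_mem_of_not_mem hS hA𝒮)]

theorem exists_isFeasible_of_mem_consistentSet (hA𝒮 : A ∉ 𝒮) (hx : x ∈ consistentSet 𝒮 p A) :
    ∃ lam, IsFeasible 𝒮 p A x lam := by
  obtain ⟨hcol, lam, hlam⟩ := isMDMRepresentable_iff.1 hx
  obtain ⟨⟨hnonneg, hsum⟩, -⟩ := (isChoiceCollection_insert_extendData hA𝒮).1 hcol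
  have hA : A ∈ insert A 𝒮 := Finset.mem_insert_self A 𝒮
  have hmem : ∀ {S}, S ∈ 𝒮 → S ∈ insert A 𝒮 := fun hS => Finset.mem_insert_of_mem hS
  have hdata : ∀ {S}, S ∈ 𝒮 → extendData p A x S = p S := fun hS =>
    extendData_of_ne (ne_of_mem_of_not_mem hS hA𝒮)
  refine ⟨lam, fun S hS i hi hle => ?_, fun S hS i hi hle => ?_, hsum, hnonneg,
    fun S hS T hT i => ?_, fun S hS T hT i => ?_⟩
  · simpa only [hdata hS, extendData_self] using hlam.le_of_lam_le (hmem hS) hA hi i.2 hle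
  · simpa only [hdata hS, extendData_self] using hlam.le_of_lam_le hA (hmem hS) i.2 hi hle
  · simpa only [hdata hS, hdata hT] using hlam.lam_lt S (hmem hS) T (hmem hT) i
  · simpa only [hdata hS, hdata hT] using hlam.lam_eq S (hmem hS) T (hmem hT) i

lemma mem_consistentSet_of_survivalCurve (hcol : IsChoiceCollection 𝒮 p) (hA𝒮 : A ∉ 𝒮)
    {G : Fin n → ℝ → ℝ} (hG : ∀ i, IsSurvivalCurve (G i))
    (hGp : ∀ S ∈ 𝒮, ∀ i ∈ S, G i (lam S) = p S i) {t : ℝ} (ht : ∑ i ∈ A, G i t = 1) :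
    (fun i : A => G i t) ∈ consistentSet 𝒮 p A := by
  refine isMDMRepresentable_iff.2 ⟨(isChoiceCollection_insert_extendData hA𝒮).2
    ⟨⟨fun i => (hG i).nonneg t, (Finset.sum_coe_sort A _).trans ht⟩, hcol⟩,
    exists_isOrderCompatible_of_survivalCurve hG ?_⟩
  rw [Finset.forall_mem_insert]
  refine ⟨⟨t, ht, fun i hi => extendData_self ⟨i, hi⟩⟩, fun S hS => ⟨lam S, ?_, ?_⟩⟩
  · rw [Finset.sum_congr rfl (hGp S hS), (hcol S hS).2]
  · rw [extendData_of_ne (ne_of_mem_of_not_mem hS hA𝒮)]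
    exact fun i hi => (hGp S hS i hi).symm

theorem IsMDMRepresentable.consistentSet_nonempty (hp : IsMDMRepresentable 𝒮 p)
    (hA : A.Nonempty) (hA𝒮 : A ∉ 𝒮) : (consistentSet 𝒮 p A).Nonempty := by
  obtain ⟨hcol, lam, hlam⟩ := isMDMRepresentable_iff.1 hp
  choose f hf hfp using fun i =>
    hlam.exists_isSurvivalOn (i := i) fun S hS hi => hcol.mem_Icc hS hi
  choose G hG hGf using fun i => (hf i).exists_isSurvivalCurve (finite_multiplierSet 𝒮 lam i)
  obtain ⟨t, ht⟩ := exists_sum_survivalCurve_eq_one hG hA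
  exact ⟨_, mem_consistentSet_of_survivalCurve hcol hA𝒮 hG
    (fun S hS i hi => (hGf i (mem_multiplierSet hS hi)).trans (hfp i S hS hi)) ht⟩

end Extension

/-! ### Feasible vectors are limits of consistent vectors -/

lemma IsSurvivalOn.mono {f : ℝ → ℝ} {s T : Set ℝ} (hf : IsSurvivalOn f T) (h : s ⊆ T) :
    IsSurvivalOn f s :=
  ⟨hf.mapsTo.mono_left h, hf.antitoneOn.mono h, hf.injOn.mono (inter_subset_inter_left _ h)⟩

-- A curve through the data is strict wherever it has to be; mixing in a little of it repairs the
-- function `g` obtained by moving its value at one point.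
lemma IsSurvivalOn.convexComb {f g : ℝ → ℝ} {T : Set ℝ} {c : ℝ} (hf : IsSurvivalOn f T)
    (hg01 : MapsTo g T (Icc 0 1)) (hg : AntitoneOn g T) (hfg : {t ∈ T | g t ≠ f t}.Subsingleton)
    (hc0 : 0 < c) (hc1 : c ≤ 1) : IsSurvivalOn (fun t => (1 - c) * g t + c * f t) T where
  mapsTo _ ht :=
    convex_Icc 0 1 (hg01 ht) (hf.mapsTo ht) (sub_nonneg.2 hc1) hc0.le (sub_add_cancel 1 c)
  antitoneOn _ ha _ hb hab := add_le_add
    (mul_le_mul_of_nonneg_left (hg ha hb hab) (sub_nonneg.2 hc1))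
    (mul_le_mul_of_nonneg_left (hf.antitoneOn ha hb hab) hc0.le)
  injOn := by
    rintro a ⟨ha, ha'⟩ b ⟨hb, hb'⟩ hab
    by_contra hne
    wlog hle : a ≤ b generalizing a b
    · exact this hb hb' ha ha' hab.symm (Ne.symm hne) (not_le.1 hle).le
    have hgle := mul_le_mul_of_nonneg_left (hg ha hb hle) (sub_nonneg.2 hc1)
    have hfeq : f a = f b :=
      (hf.antitoneOn ha hb hle).antisymm' (le_of_mul_le_mul_left (by linarith) hc0)
    have hfIoo : f a ∈ Ioo 0 1 := by
      by_cases hga : g a = f a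
      · simpa [hga, ← add_mul] using ha'
      by_cases hgb : g b = f b
      · simpa [hgb, ← add_mul, hfeq] using hb'
      · exact absurd (hfg ⟨ha, hga⟩ ⟨hb, hgb⟩) hne
    exact hne (hf.injOn ⟨ha, hfIoo⟩ ⟨hb, mem_preimage.2 (hfeq ▸ hfIoo)⟩ hfeq)

lemma eqOn_update_of_forall_le {f : ℝ → ℝ} {T : Set ℝ} {a x : ℝ}
    (hle : ∀ b ∈ T, b ≤ a → x ≤ f b) (hge : ∀ b ∈ T, a ≤ b → f b ≤ x) :
    EqOn (Function.update f a x) f T := by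
  intro b hb
  obtain rfl | hba := eq_or_ne b a
  · rw [Function.update_self]
    exact (hle b hb le_rfl).antisymm (hge b hb le_rfl)
  · exact Function.update_of_ne hba x f

lemma IsSurvivalOn.convexComb_update {f : ℝ → ℝ} {T : Set ℝ} {a x c : ℝ}
    (hf : IsSurvivalOn f (insert a T)) (hx : x ∈ Icc 0 1) (hle : ∀ b ∈ T, b ≤ a → x ≤ f b)
    (hge : ∀ b ∈ T, a ≤ b → f b ≤ x) (hc0 : 0 < c) (hc1 : c ≤ 1) :
    IsSurvivalOn (fun t => (1 - c) * Function.update f a x t + c * f t) (insert a T) := by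
  have heq := eqOn_update_of_forall_le hle hge
  have hfT := hf.mono (subset_insert a T)
  refine hf.convexComb (forall_mem_insert.2 ⟨?_, hfT.mapsTo.congr heq.symm⟩)
    (antitoneOn_insert_iff.2 ⟨fun b hb hba => ?_, fun b hb hab => ?_,
      hfT.antitoneOn.congr heq.symm⟩) ?_ hc0 hc1
  · rwa [Function.update_self]
  · rw [Function.update_self, heq hb]
    exact hle b hb hba
  · rw [Function.update_self, heq hb]
    exact hge b hb hab
  · exact subsingleton_of_subset_singleton fun t ht =>
      not_not.1 fun hta => ht.2 (Function.update_of_ne hta x f)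

theorem IsSurvivalOn.exists_isSurvivalCurve_abs_sub_le {f : ℝ → ℝ} {T : Set ℝ} {a x δ : ℝ}
    (hf : IsSurvivalOn f T) (hT : T.Finite) (hx : x ∈ Icc 0 1)
    (hle : ∀ b ∈ T, b ≤ a → x ≤ f b) (hge : ∀ b ∈ T, a ≤ b → f b ≤ x) (hδ : 0 < δ) :
    ∃ G, IsSurvivalCurve G ∧ EqOn G f T ∧ |G a - x| ≤ δ := by
  obtain ⟨K, hK, hKf⟩ := hf.exists_isSurvivalCurve hT
  have hleK : ∀ b ∈ T, b ≤ a → x ≤ K b := fun b hb hba => hKf hb ▸ hle b hb hba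
  have hgeK : ∀ b ∈ T, a ≤ b → K b ≤ x := fun b hb hab => hKf hb ▸ hge b hb hab
  obtain ⟨c, ⟨hc0, hc1⟩, hcδ⟩ : ∃ c, (0 < c ∧ c ≤ 1) ∧ c ≤ δ :=
    ⟨min 1 δ, ⟨lt_min one_pos hδ, min_le_left _ _⟩, min_le_right _ _⟩
  obtain ⟨G, hG, hGK⟩ := ((hK.toIsSurvivalOn.mono (subset_univ _)).convexComb_update hx hleK hgeK
    hc0 hc1).exists_isSurvivalCurve (hT.insert a)
  simp only [EqOn] at hGK
  refine ⟨G, hG, fun b hb => ?_, ?_⟩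
  · rw [hGK (mem_insert_of_mem a hb), eqOn_update_of_forall_le hleK hgeK hb, hKf hb, ← add_mul,
      sub_add_cancel, one_mul]
  · have hdist : |K a - x| ≤ 1 := abs_sub_le_iff.2
      ⟨by linarith [hK.le_one a, hx.1], by linarith [hK.nonneg a, hx.2]⟩
    calc |G a - x| = c * |K a - x| := by
          rw [hGK (mem_insert a T), Function.update_self, ← abs_of_pos hc0, ← abs_mul,
            abs_of_pos hc0]
          ring_nf
      _ ≤ c := mul_le_of_le_one_right hc0.le hdist
      _ ≤ δ := hcδ

lemma exists_sum_eq_one_and_abs_sub_le {ι : Type*} {G : ι → ℝ → ℝ} {A : Finset ι}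
    (hG : ∀ i, IsSurvivalCurve (G i)) (hA : A.Nonempty) (s : ℝ) :
    ∃ t, ∑ i ∈ A, G i t = 1 ∧ ∀ i ∈ A, |G i t - G i s| ≤ |1 - ∑ j ∈ A, G j s| := by
  obtain ⟨t, ht⟩ := exists_sum_survivalCurve_eq_one hG hA
  have hsum : ∑ j ∈ A, |G j t - G j s| = |1 - ∑ j ∈ A, G j s| := by
    rw [← ht, ← Finset.sum_sub_distrib]
    rcases le_total t s with hts | hst
    · have hnonneg : ∀ j ∈ A, 0 ≤ G j t - G j s := fun j _ => sub_nonneg.2 ((hG j).antitone hts)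
      rw [Finset.abs_sum_of_nonneg hnonneg]
      exact Finset.sum_congr rfl fun j hj => abs_of_nonneg (hnonneg j hj)
    · have hnonpos : ∀ j ∈ A, G j t - G j s ≤ 0 := fun j _ => sub_nonpos.2 ((hG j).antitone hst)
      rw [abs_of_nonpos (Finset.sum_nonpos hnonpos), ← Finset.sum_neg_distrib]
      exact Finset.sum_congr rfl fun j hj => abs_of_nonpos (hnonpos j hj)
  refine ⟨t, ht, fun i hi => hsum ▸ ?_⟩
  exact Finset.single_le_sum (f := fun j => |G j t - G j s|) (fun j _ => abs_nonneg _) hi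

section Closure

variable {n : ℕ} {𝒮 : Finset (Finset (Fin n))} {p : Finset (Fin n) → Fin n → ℝ}
  {A : Finset (Fin n)} {x : A → ℝ} {lam : Finset (Fin n) → ℝ}

namespace IsFeasible

lemma isOrderCompatible (hx : IsFeasible 𝒮 p A x lam) : IsOrderCompatible 𝒮 p lam :=
  ⟨hx.lam_lt, hx.lam_eq⟩

lemma mem_Icc (hx : IsFeasible 𝒮 p A x lam) (i : A) : x i ∈ Icc 0 1 :=
  ⟨hx.nonneg i, hx.sum_eq_one ▸ Finset.single_le_sum (fun j _ => hx.nonneg j) (Finset.mem_univ i)⟩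

lemma exists_isSurvivalCurve (hx : IsFeasible 𝒮 p A x lam) (hcol : IsChoiceCollection 𝒮 p)
    {δ : ℝ} (hδ : 0 < δ) (i : Fin n) :
    ∃ G, IsSurvivalCurve G ∧ (∀ S ∈ 𝒮, i ∈ S → G (lam S) = p S i) ∧
      ∀ hi : i ∈ A, |G (lam A) - x ⟨i, hi⟩| ≤ δ := by
  obtain ⟨f, hf, hfp⟩ :=
    hx.isOrderCompatible.exists_isSurvivalOn (i := i) fun S hS hi => hcol.mem_Icc hS hi
  have hT := finite_multiplierSet 𝒮 lam i
  by_cases hi : i ∈ A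
  · obtain ⟨G, hG, hGf, hGx⟩ := hf.exists_isSurvivalCurve_abs_sub_le hT (hx.mem_Icc ⟨i, hi⟩)
      (a := lam A) (by
        rintro _ ⟨S, ⟨hS, hiS⟩, rfl⟩ hle
        exact hfp S hS hiS ▸ hx.le_data S hS ⟨i, hi⟩ hiS hle) (by
        rintro _ ⟨S, ⟨hS, hiS⟩, rfl⟩ hle
        exact hfp S hS hiS ▸ hx.data_le S hS ⟨i, hi⟩ hiS hle) hδ
    exact ⟨G, hG, fun S hS hiS => (hGf (mem_multiplierSet hS hiS)).trans (hfp S hS hiS),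
      fun _ => hGx⟩
  · obtain ⟨G, hG, hGf⟩ := hf.exists_isSurvivalCurve hT
    exact ⟨G, hG, fun S hS hiS => (hGf (mem_multiplierSet hS hiS)).trans (hfp S hS hiS),
      fun hi' => absurd hi' hi⟩

theorem mem_closure_consistentSet (hx : IsFeasible 𝒮 p A x lam) (hcol : IsChoiceCollection 𝒮 p)
    (hA : A.Nonempty) (hA𝒮 : A ∉ 𝒮) : x ∈ closure (consistentSet 𝒮 p A) := by
  rw [Metric.mem_closure_iff]
  intro ε hε
  obtain ⟨δ, hδ, hδε⟩ : ∃ δ > 0, (A.card + 1) * δ < ε :=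
    (exists_pos_mul_lt hε _).imp fun δ h => h
  choose G hG hGp hGx using hx.exists_isSurvivalCurve hcol hδ
  have hdefect : |1 - ∑ i ∈ A, G i (lam A)| ≤ A.card * δ := by
    rw [← hx.sum_eq_one, ← Finset.sum_coe_sort A, ← Finset.sum_sub_distrib]
    calc |∑ i : A, (x i - G i (lam A))| ≤ ∑ i : A, |x i - G i (lam A)| :=
          Finset.abs_sum_le_sum_abs _ _
      _ ≤ ∑ _i : A, δ := Finset.sum_le_sum fun i _ => abs_sub_comm (x i) _ ▸ hGx i i.2
      _ = A.card * δ := by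
          rw [Finset.sum_const, Finset.card_univ, Fintype.card_coe, nsmul_eq_mul]
  obtain ⟨t, ht, hmove⟩ := exists_sum_eq_one_and_abs_sub_le hG hA (lam A)
  refine ⟨_, mem_consistentSet_of_survivalCurve hcol hA𝒮 hG (fun S hS i hi => hGp i S hS hi) ht,
    (dist_pi_lt_iff hε).2 fun i => ?_⟩
  rw [dist_comm, Real.dist_eq]
  calc |G i t - x i| ≤ |G i t - G i (lam A)| + |G i (lam A) - x i| := abs_sub_le _ _ _
    _ ≤ A.card * δ + δ := add_le_add ((hmove i i.2).trans hdefect) (hGx i i.2)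
    _ = (A.card + 1) * δ := by ring
    _ < ε := hδε

end IsFeasible

/-- The vectors that satisfy the constraints of the reformulation on the variables `x` when `U` and
`V` are the assortments whose multipliers are at most, respectively at least, that of `A`. -/
def constraintPolytope (p : Finset (Fin n) → Fin n → ℝ) (A : Finset (Fin n))
    (U V : Finset (Finset (Fin n))) : Set (A → ℝ) :=
  {x | (∀ S ∈ U, ∀ i : A, (i : Fin n) ∈ S → x i ≤ p S i) ∧
    (∀ S ∈ V, ∀ i : A, (i : Fin n) ∈ S → p S i ≤ x i) ∧ ∑ i, x i = 1 ∧ ∀ i, 0 ≤ x i}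

lemma isClosed_constraintPolytope (p : Finset (Fin n) → Fin n → ℝ) (A : Finset (Fin n))
    (U V : Finset (Finset (Fin n))) : IsClosed (constraintPolytope p A U V) := by
  simp only [constraintPolytope, ofPred_and, ofPred_forall]
  refine .inter ?_ (.inter ?_ (.inter ?_ ?_))
  · exact isClosed_biInter fun S _ => isClosed_iInter fun i => isClosed_iInter fun _ =>
      isClosed_le (continuous_apply i) continuous_const
  · exact isClosed_biInter fun S _ => isClosed_iInter fun i => isClosed_iInter fun _ =>
      isClosed_le continuous_const (continuous_apply i)
  · exact isClosed_eq (continuous_finsetSum _ fun i _ => continuous_apply i) continuous_const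
  · exact isClosed_iInter fun i => isClosed_le continuous_const (continuous_apply i)

lemma isFeasible_iff : IsFeasible 𝒮 p A x lam ↔ IsOrderCompatible 𝒮 p lam ∧
    x ∈ constraintPolytope p A {S ∈ 𝒮 | lam S ≤ lam A} {S ∈ 𝒮 | lam A ≤ lam S} := by
  simp only [constraintPolytope, Finset.mem_filter, mem_ofPred_eq, and_imp]
  exact ⟨fun h => ⟨h.isOrderCompatible, fun S hS hle i hi => h.le_data S hS i hi hle,
      fun S hS hle i hi => h.data_le S hS i hi hle, h.sum_eq_one, h.nonneg⟩,
    fun ⟨hlam, hU, hV, hsum, hnonneg⟩ => ⟨fun S hS i hi hle => hU S hS hle i hi,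
      fun S hS i hi hle => hV S hS hle i hi, hsum, hnonneg, hlam.lam_lt, hlam.lam_eq⟩⟩

-- Infinitely many multipliers, but only finitely many ways to compare them with that of `A`.
lemma isClosed_setOf_exists_isFeasible (𝒮 : Finset (Finset (Fin n)))
    (p : Finset (Fin n) → Fin n → ℝ) (A : Finset (Fin n)) :
    IsClosed {x : A → ℝ | ∃ lam, IsFeasible 𝒮 p A x lam} := by
  have hunion : {x : A → ℝ | ∃ lam, IsFeasible 𝒮 p A x lam} =
      ⋃ P ∈ (fun lam : Finset (Fin n) → ℝ =>
        ({S ∈ 𝒮 | lam S ≤ lam A}, {S ∈ 𝒮 | lam A ≤ lam S})) '' {lam | IsOrderCompatible 𝒮 p lam},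
        constraintPolytope p A P.1 P.2 := by
    ext x
    simp only [biUnion_image, mem_iUnion, mem_ofPred_eq, isFeasible_iff, exists_prop]
  rw [hunion]
  exact (toFinite _).isClosed_biUnion fun P _ => isClosed_constraintPolytope p A P.1 P.2

theorem closure_consistentSet (hcol : IsChoiceCollection 𝒮 p) (hA : A.Nonempty) (hA𝒮 : A ∉ 𝒮) :
    closure (consistentSet 𝒮 p A) = {x : A → ℝ | ∃ lam, IsFeasible 𝒮 p A x lam} :=
  (closure_minimal (fun _ hx => exists_isFeasible_of_mem_consistentSet hA𝒮 hx)
    (isClosed_setOf_exists_isFeasible 𝒮 p A)).antisymm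
    fun _ ⟨_, hx⟩ => hx.mem_closure_consistentSet hcol hA hA𝒮

lemma isCompact_closure_consistentSet (hA𝒮 : A ∉ 𝒮) :
    IsCompact (closure (consistentSet 𝒮 p A)) := by
  refine isCompact_Icc.closure_of_subset (K := Icc 0 1) fun x hx => ?_
  obtain ⟨lam, hlam⟩ := exists_isFeasible_of_mem_consistentSet hA𝒮 hx
  exact ⟨fun i => (hlam.mem_Icc i).1, fun i => (hlam.mem_Icc i).2⟩

lemma continuous_revenue (r : Fin n → ℝ) (A : Finset (Fin n)) : Continuous (revenue r A) :=
  continuous_finsetSum _ fun i _ => continuous_const.mul (continuous_apply i)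

end Closure

theorem proposition1_general {n : ℕ} (𝒮 : Finset (Finset (Fin n)))
    (p : Finset (Fin n) → Fin n → ℝ) (hp : IsMDMRepresentable 𝒮 p) (A : Finset (Fin n))
    (hA : A.Nonempty) (hA𝒮 : A ∉ 𝒮) (r : Fin n → ℝ) :
    IsGLB (revenue r A '' consistentSet 𝒮 p A) (worstCaseRevenue 𝒮 p r A) ∧
      IsLeast {v : ℝ | ∃ (x : A → ℝ) (lam : Finset (Fin n) → ℝ),
        IsFeasible 𝒮 p A x lam ∧ v = revenue r A x} (worstCaseRevenue 𝒮 p r A) ∧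
      closure (consistentSet 𝒮 p A) =
        {x : A → ℝ | ∃ lam : Finset (Fin n) → ℝ, IsFeasible 𝒮 p A x lam} := by
  have hclosure := closure_consistentSet hp.1 hA hA𝒮
  have hcompact : IsCompact (closure (consistentSet 𝒮 p A)) := isCompact_closure_consistentSet hA𝒮
  have hcont := continuous_revenue r A
  have hne := (hp.consistentSet_nonempty hA hA𝒮).image (revenue r A)
  have hbdd : BddBelow (revenue r A '' consistentSet 𝒮 p A) :=
    (hcompact.image hcont).bddBelow.mono (image_mono subset_closure)
  have hvalues : {v : ℝ | ∃ (x : A → ℝ) (lam : Finset (Fin n) → ℝ),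
      IsFeasible 𝒮 p A x lam ∧ v = revenue r A x} =
      closure (revenue r A '' consistentSet 𝒮 p A) := by
    rw [← image_closure_of_isCompact hcompact hcont.continuousOn, hclosure]
    ext v
    simp only [mem_ofPred_eq, mem_image, ← exists_and_right, eq_comm]
  have hglb : IsGLB (revenue r A '' consistentSet 𝒮 p A) (worstCaseRevenue 𝒮 p r A) :=
    isGLB_csInf hne hbdd
  refine ⟨hglb, ?_, hclosure⟩
  rw [hvalues]
  exact ⟨csInf_mem_closure hne hbdd, by rw [lowerBounds_closure]; exact hglb.1⟩

theorem proposition1 {n : ℕ} (𝒮 : Finset (Finset (Fin n))) (p : Finset (Fin n) → Fin n → ℝ)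
    (hp : IsMDMRepresentable 𝒮 p) (A : Finset (Fin n)) (hA : A.Nonempty) (hA𝒮 : A ∉ 𝒮)
    (r : Fin n → ℝ) (hr : ∀ i, 0 < r i) :
    IsGLB (revenue r A '' consistentSet 𝒮 p A) (worstCaseRevenue 𝒮 p r A) ∧
      IsLeast {v : ℝ | ∃ (x : A → ℝ) (lam : Finset (Fin n) → ℝ),
        IsFeasible 𝒮 p A x lam ∧ v = revenue r A x} (worstCaseRevenue 𝒮 p r A) ∧
      closure (consistentSet 𝒮 p A) =
        {x : A → ℝ | ∃ lam : Finset (Fin n) → ℝ, IsFeasible 𝒮 p A x lam} :=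
  proposition1_general 𝒮 p hp A hA hA𝒮 r
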